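/- Let $T^r=(S^1)^r$ and let $\rho:T^r\to GL(n,\mathbb C)$ be a continuous homomorphism such that every holomorphic function on $\mathbb C^n$ that is invariant under $\rho$ is constant. For $\mathbf k=(k_1,\dots,k_r)\in\mathbb Z^r$ let $V_{\mathbf k}$ be the space of polynomials $\varphi$ on $\mathbb C^n$ with $\varphi(\rho(\lambda)z)=\lambda_1^{k_1}\cdots\lambda_r^{k_r}\,\varphi(z)$ for all $\lambda\in T^r$ and $z\in\mathbb C^n$. Let $d_{\mathbf k}$ be the minimum of the degrees of the nonzero elements of $V_{\mathbf k}$ ($d_{\mathbf k}=\infty$ if $V_{\mathbf k}=0$) and let $D_{\mathbf k}$ be the maximum of the degrees of the elements of $V_{\mathbf k}$. The resonance order of $\rho$ is $\mu_\rho=\max\{D_{\mathbf k} : \mathbf k\in\mathbb Z^r,\ d_{\mathbf k}=1\}$. Let $D\subset\mathbb C^n$ be a bounded quasi-Reinhardt domain with respect to $\rho$, that is, a bounded, connected, open set with $\rho(\lambda)D\subset D$ for all $\lambda\in T^r$, and suppose $0\in D$. If $\mu_\rho=1$, then every automorphism $f$ of $D$ (a biholomorphic map of $D$ onto itself) with $f(0)=0$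 is linear, i.e. it is the restriction to $D$ of a $\mathbb C$-linear map $\mathbb C^n\to\mathbb C^n$. -/

import Mathlib

namespace QuasiReinhardt

/-- The torus `T^r = (S¹)^r`, with its product group structure and topology. -/
abbrev Torus (r : ℕ) : Type := Fin r → Circle

/-- The action of `t ∈ T^r` on `ℂⁿ` given by a homomorphism `ρ : T^r → GL(n, ℂ)`. -/
noncomputable def act {r n : ℕ} (ρ : Torus r →* Matrix.GeneralLinearGroup (Fin n) ℂ) (t : Torus r)
    (z : Fin n → ℂ) : Fin n → ℂ :=
  (ρ t : Matrix (Fin n) (Fin n) ℂ).mulVec z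

/-- The algebra of `ρ`-invariant entire functions on `ℂⁿ` consists of the constants. -/
def InvariantsConstant {r n : ℕ} (ρ : Torus r →* Matrix.GeneralLinearGroup (Fin n) ℂ) : Prop :=
  ∀ g : (Fin n → ℂ) → ℂ, Differentiable ℂ g → (∀ t z, g (act ρ t z) = g z) →
    ∃ c : ℂ, ∀ z, g z = c

/-- `D` is a domain (open, connected, non-empty) in `ℂⁿ` that is invariant under `ρ`. -/
structure IsQuasiReinhardt {r n : ℕ} (ρ : Torus r →* Matrix.GeneralLinearGroup (Fin n) ℂ)
    (D : Set (Fin n → ℂ)) : Prop where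
  isOpen : IsOpen D
  isConnected : IsConnected D
  invariant : ∀ t, ∀ z ∈ D, act ρ t z ∈ D

/-- The character `t ↦ t^k = t₁^{k₁} ⋯ t_r^{k_r}` of the torus, for `k ∈ ℤ^r`. -/
noncomputable def character {r : ℕ} (k : Fin r → ℤ) (t : Torus r) : ℂ :=
  ∏ j, (t j : ℂ) ^ k j

/-- The weight space `V_k`: the polynomials `p` on `ℂⁿ` with `p(ρ(t)z) = t^k p(z)` for all
`t ∈ T^r` and `z ∈ ℂⁿ`. -/
noncomputable def weightSpace {r n : ℕ} (ρ : Torus r →* Matrix.GeneralLinearGroup (Fin n) ℂ)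
    (k : Fin r → ℤ) : Submodule ℂ (MvPolynomial (Fin n) ℂ) where
  carrier := {p | ∀ t z, MvPolynomial.eval (act ρ t z) p = character k t * MvPolynomial.eval z p}
  zero_mem' := by intro t z; simp
  add_mem' := by
    intro p q hp hq t z
    rw [map_add, map_add, hp t z, hq t z, mul_add]
  smul_mem' := by
    intro c p hp t z
    rw [MvPolynomial.smul_eval, MvPolynomial.smul_eval, hp t z, mul_left_comm]

/-- `d_k`: the minimum of the degrees of the non-zero elements of `V_k` (`⊤` if `V_k = 0`). -/
noncomputable def minDegree {r n : ℕ} (ρ : Torus r →* Matrix.GeneralLinearGroup (Fin n) ℂ)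
    (k : Fin r → ℤ) : ℕ∞ :=
  ⨅ p ∈ {p : MvPolynomial (Fin n) ℂ | p ∈ weightSpace ρ k ∧ p ≠ 0}, (p.totalDegree : ℕ∞)

/-- `D_k`: the maximum of the degrees of the elements of `V_k`
(`⊤` if these degrees are unbounded). -/
noncomputable def maxDegree {r n : ℕ} (ρ : Torus r →* Matrix.GeneralLinearGroup (Fin n) ℂ)
    (k : Fin r → ℤ) : ℕ∞ :=
  ⨆ p ∈ weightSpace ρ k, (p.totalDegree : ℕ∞)

/-- The resonance order `μ_ρ`: the maximum of `D_k` over all `k ∈ ℤ^r` with `d_k = 1`. -/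
noncomputable def resonanceOrder {r n : ℕ}
    (ρ : Torus r →* Matrix.GeneralLinearGroup (Fin n) ℂ) : ℕ∞ :=
  ⨆ k ∈ {k : Fin r → ℤ | minDegree ρ k = 1}, maxDegree ρ k

/-- `f` restricts to an automorphism of `D`: a holomorphic bijection of `D` onto itself with
holomorphic inverse. -/
def IsAutomorphism {n : ℕ} (D : Set (Fin n → ℂ)) (f : (Fin n → ℂ) → (Fin n → ℂ)) : Prop :=
  DifferentiableOn ℂ f D ∧ Set.MapsTo f D D ∧
    ∃ g : (Fin n → ℂ) → (Fin n → ℂ),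
      DifferentiableOn ℂ g D ∧ Set.MapsTo g D D ∧ Set.InvOn g f D D

end QuasiReinhardt

/-! The proof removes the Taylor terms at the origin degree by degree, for all automorphisms fixing
`0` at once. Suppose none of them has terms of degree strictly between 1 and m. Write A_k for the
derivative of k at 0, k_m for its term of degree m, and c(k) = A_k⁻¹ k_m. The chain rule
(`multilinear_diagonal_comp`) makes c a cocycle: c(k∘l) = c(l) + A_l⁻¹ c(k) A_l. It vanishes on the
torus, which acts linearly.

If w = c(k) ≠ 0, replace l by k∘ρ(x)∘l. This adds A_l⁻¹ρ(-x) w ρ(x)A_l to c(l). The mean of ρ(-x) w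
ρ(x) over the torus is an equivariant homogeneous map of degree m ≥ 2. Pairing it with an eigenform
would produce a resonance, so it is zero (`equivariant_multilinear_apply_eq_zero`). Hence the cross
term of the squared norms has mean zero, and for some x the energy of c grows by at least the energy
of the added term (`exists_gridEnergy_add_le`). By compactness that gain has a uniform positive
lower bound (`exists_pos_le_gridEnergy`). Iterating makes the energy unbounded, against Cauchy's
estimates on the bounded domain (`exists_bound_isOriginAutomorphism`). -/

open Metric Set Filter Topology MeasureTheory

/-! ### Holomorphic maps of several variables: Cauchy estimates, smoothness, Taylor expansion. -/

section SeveralVariables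

variable {E F : Type*} [NormedAddCommGroup E] [NormedSpace ℂ E] [NormedAddCommGroup F]
  [NormedSpace ℂ F]

/-- Restriction of a holomorphic function to a complex line. -/
theorem differentiableOn_comp_line {f : E → F} {s : Set E} (hf : DifferentiableOn ℂ f s) (z w : E) :
    DifferentiableOn ℂ (fun t : ℂ => f (z + t • w)) ((fun t : ℂ => z + t • w) ⁻¹' s) :=
  hf.comp (by fun_prop) (fun _ h => h)

theorem fderiv_apply_eq_deriv_line {f : E → F} {z : E} (hf : DifferentiableAt ℂ f z) (w : E) :
    fderiv ℂ f z w = deriv (fun t : ℂ => f (z + t • w)) 0 := by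
  rw [← hf.lineDeriv_eq_fderiv]; rfl

theorem add_smul_mem_closedBall {z w : E} {t : ℂ} {R r : ℝ} (ht : ‖t‖ ≤ R) (hw : R * ‖w‖ ≤ r) :
    z + t • w ∈ closedBall z r := by
  rw [mem_closedBall, dist_self_add_left, norm_smul]
  exact (mul_le_mul_of_nonneg_right ht (norm_nonneg _)).trans hw

/-- Cauchy's estimate for the Fréchet derivative. -/
theorem norm_fderiv_le_of_forall_mem_closedBall {f : E → F} {s : Set E} (hs : IsOpen s)
    (hf : DifferentiableOn ℂ f s) {z : E} {r M : ℝ} (hr : 0 < r) (hrs : closedBall z r ⊆ s)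
    (hM : ∀ y ∈ closedBall z r, ‖f y‖ ≤ M) : ‖fderiv ℂ f z‖ ≤ M / r := by
  have hM0 : 0 ≤ M := (norm_nonneg _).trans (hM z (mem_closedBall_self hr.le))
  refine ContinuousLinearMap.opNorm_le_bound _ (by positivity) fun w => ?_
  rcases eq_or_ne w 0 with rfl | hw
  · simp
  have hw' : 0 < ‖w‖ := norm_pos_iff.2 hw
  have hz : z ∈ s := hrs (mem_closedBall_self hr.le)
  rw [fderiv_apply_eq_deriv_line ((hf z hz).differentiableAt (hs.mem_nhds hz))]
  have hR : r / ‖w‖ * ‖w‖ ≤ r := by rw [div_mul_cancel₀ _ hw'.ne']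
  have key := Complex.norm_deriv_le_of_forall_mem_sphere_norm_le (c := 0) (R := r / ‖w‖) (C := M)
    (f := fun t : ℂ => f (z + t • w)) (by positivity) ?_ ?_
  · refine key.trans (le_of_eq ?_)
    field_simp
  · refine DifferentiableOn.diffContOnCl_ball (U := (fun t : ℂ => z + t • w) ⁻¹' s)
      (differentiableOn_comp_line hf z w) fun t ht => hrs (add_smul_mem_closedBall ?_ hR)
    simpa using ht
  · intro t ht
    exact hM _ (add_smul_mem_closedBall (by simpa using ht.le) hR)

/-- The homogeneous term of degree `m` of the Taylor expansion of `f` at the origin. -/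
noncomputable def taylorTerm (m : ℕ) (f : E → F) : E [×m]→L[ℂ] F :=
  (m.factorial : ℂ)⁻¹ • iteratedFDeriv ℂ m f 0

theorem taylorTerm_zero (f : E → F) (v : Fin 0 → E) : taylorTerm 0 f v = f 0 := by
  simp [taylorTerm]

theorem taylorTerm_one (f : E → F) (z : E) : taylorTerm 1 f (fun _ => z) = fderiv ℂ f 0 z := by
  simp [taylorTerm]

variable [FiniteDimensional ℂ E] [FiniteDimensional ℂ F]

/-- The directional derivatives of a holomorphic function are holomorphic. -/
theorem differentiableOn_fderiv_apply {f : E → F} {s : Set E}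
    (hf : DifferentiableOn ℂ f s) (hs : IsOpen s) (w : E) :
    DifferentiableOn ℂ (fun z => fderiv ℂ f z w) s := by
  intro z₀ hz₀
  refine DifferentiableAt.differentiableWithinAt ?_
  have : ProperSpace E := FiniteDimensional.proper ℂ E
  have : CompleteSpace F := FiniteDimensional.complete ℂ F
  have : ProperSpace (E →L[ℂ] F) := FiniteDimensional.proper ℂ _
  borelize E
  -- One `r` for moving the base point, one for the Cauchy circle in direction `w`, one for the ball
  -- used to estimate the derivative there.
  obtain ⟨r, hr, hrs⟩ : ∃ r > 0, closedBall z₀ (3 * r) ⊆ s := by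
    obtain ⟨ε, hε, h⟩ := nhds_basis_closedBall.mem_iff.1 (hs.mem_nhds hz₀)
    exact ⟨ε / 3, by positivity, by rwa [mul_div_cancel₀ _ (by norm_num)]⟩
  obtain ⟨M, hM⟩ := (isCompact_closedBall z₀ (3 * r)).exists_bound_of_continuousOn
    (hf.continuousOn.mono hrs)
  obtain ⟨ε, hε, hεw⟩ : ∃ ε > 0, ε * ‖w‖ ≤ r := by
    refine ⟨r / (‖w‖ + 1), by positivity, ?_⟩
    rw [div_mul_eq_mul_div, div_le_iff₀ (by positivity)]
    nlinarith [norm_nonneg w]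
  have hc : ∀ θ : ℝ, ‖circleMap 0 ε θ‖ = ε := fun θ => by simp [abs_of_pos hε]
  have hmem : ∀ x ∈ ball z₀ r, ∀ t : ℂ, ‖t‖ ≤ ε → closedBall (x + t • w) r ⊆ closedBall z₀ (3 * r) := by
    intro x hx t ht
    refine closedBall_subset_closedBall' ?_
    have h1 : dist (x + t • w) x ≤ r := add_smul_mem_closedBall ht hεw
    have h2 : dist x z₀ < r := hx
    linarith [dist_triangle (x + t • w) x z₀]
  have hmem' : ∀ x ∈ ball z₀ r, ∀ t : ℂ, ‖t‖ ≤ ε → x + t • w ∈ s := fun x hx t ht =>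
    hrs (hmem x hx t ht (mem_closedBall_self hr.le))
  -- `G` is the integrand of Cauchy's formula for the derivative along `w`, up to the factor
  -- 1/(2πi); `G'` is its derivative in `x`. Differentiating under the integral then shows that the
  -- directional derivative is differentiable.
  let G : E → ℝ → F := fun x θ =>
    deriv (circleMap 0 ε) θ • ((1 / (circleMap 0 ε θ - 0) ^ 2) • f (x + circleMap 0 ε θ • w))
  let G' : E → ℝ → E →L[ℂ] F := fun x θ => deriv (circleMap 0 ε) θ •
    ((1 / (circleMap 0 ε θ - 0) ^ 2) • fderiv ℂ f (x + circleMap 0 ε θ • w))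
  have hpow : Continuous fun θ : ℝ => (1 / (circleMap 0 ε θ - 0) ^ 2) := by
    refine Continuous.div₀ (by fun_prop) (by fun_prop) fun θ => pow_ne_zero _ ?_
    rw [sub_zero, ← norm_pos_iff, hc]; exact hε
  have hder : Continuous fun θ : ℝ => deriv (circleMap 0 ε) θ := by
    simp only [deriv_circleMap]; fun_prop
  have hGcont : ∀ x ∈ ball z₀ r, Continuous (G x) := by
    intro x hx
    refine hder.smul (hpow.smul ?_)
    refine hf.continuousOn.comp_continuous (by fun_prop) fun θ => hmem' x hx _ (hc θ).le
  have hball : ∀ᶠ x in 𝓝 z₀, x ∈ ball z₀ r := ball_mem_nhds z₀ hr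
  have hder' : HasFDerivAt (fun x => ∫ θ in (0 : ℝ)..2 * Real.pi, G x θ)
      (∫ θ in (0 : ℝ)..2 * Real.pi, G' z₀ θ) z₀ := by
    refine intervalIntegral.hasFDerivAt_integral_of_dominated_of_fderiv_le
      (bound := fun _ => ε * (1 / ε ^ 2 * (M / r))) (ball_mem_nhds z₀ hr) ?_ ?_ ?_ ?_ ?_ ?_
    · exact hball.mono fun x hx => (hGcont x hx).aestronglyMeasurable
    · exact (hGcont z₀ (mem_ball_self hr)).intervalIntegrable _ _
    · refine AEStronglyMeasurable.smul hder.aestronglyMeasurable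
        (AEStronglyMeasurable.smul hpow.aestronglyMeasurable ?_)
      -- Continuity of `fderiv ℂ f` is not known at this stage, but measurability is enough.
      refine Measurable.aestronglyMeasurable ?_
      exact (measurable_fderiv ℂ f).comp (by fun_prop : Continuous _).measurable
    · refine Eventually.of_forall fun θ _ x hx => ?_
      have h1 := norm_fderiv_le_of_forall_mem_closedBall hs hf (z := x + circleMap 0 ε θ • w) hr
        ((hmem x hx _ (hc θ).le).trans hrs) (fun y hy => hM y (hmem x hx _ (hc θ).le hy))
      simp only [G', norm_smul, norm_div, norm_one, norm_pow, deriv_circleMap, norm_mul, Complex.norm_I, mul_one,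
        sub_zero, hc]
      gcongr
    · exact intervalIntegrable_const
    · refine Eventually.of_forall fun θ _ x hx => ?_
      have hx' := hmem' x hx _ (hc θ).le
      have h1 : HasFDerivAt f (fderiv ℂ f (x + circleMap 0 ε θ • w)) (x + circleMap 0 ε θ • w) :=
        ((hf _ hx').differentiableAt (hs.mem_nhds hx')).hasFDerivAt
      exact (((hasFDerivAt_comp_add_right _).2 h1).const_smul _).const_smul _
  have heq : (fun z => fderiv ℂ f z w) =ᶠ[𝓝 z₀]
      fun x => (2 * Real.pi * Complex.I : ℂ)⁻¹ • ∫ θ in (0 : ℝ)..2 * Real.pi, G x θ := by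
    filter_upwards [hball] with x hx
    have hxs : x ∈ s := by simpa using hmem' x hx 0 (by simpa using hε.le)
    rw [fderiv_apply_eq_deriv_line ((hf x hxs).differentiableAt (hs.mem_nhds hxs)),
      eq_inv_smul_iff₀ Complex.two_pi_I_ne_zero]
    refine (DiffContOnCl.deriv_eq_smul_circleIntegral hε ?_).symm
    refine DifferentiableOn.diffContOnCl_ball (U := (fun t : ℂ => x + t • w) ⁻¹' s)
      (differentiableOn_comp_line hf x w) fun t ht => hmem' x hx t (by simpa using ht)
  exact (hder'.differentiableAt.const_smul _).congr_of_eventuallyEq heq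

/-- Holomorphic functions of several variables are infinitely differentiable. -/
theorem contDiffOn_of_differentiableOn_complex {f : E → F} {s : Set E}
    (hf : DifferentiableOn ℂ f s) (hs : IsOpen s) (n : ℕ) : ContDiffOn ℂ n f s := by
  induction n generalizing f with
  | zero => simpa using hf.continuousOn
  | succ n ih =>
    rw [Nat.cast_succ, contDiffOn_succ_iff_fderiv_apply hs.uniqueDiffOn]
    refine ⟨hf, by simp, fun w => ?_⟩
    refine (ih (differentiableOn_fderiv_apply hf hs w)).congr fun x hx => ?_
    rw [fderivWithin_of_isOpen hs hx]

theorem iteratedDeriv_line_eq {f : E → F} {s : Set E} (hf : DifferentiableOn ℂ f s)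
    (hs : IsOpen s) (h0 : (0 : E) ∈ s) (m : ℕ) (z : E) :
    iteratedDeriv m (fun t : ℂ => f (t • z)) 0 = iteratedFDeriv ℂ m f 0 fun _ => z := by
  let g : ℂ →L[ℂ] E := ContinuousLinearMap.toSpanSingleton ℂ z
  have hg : g 0 = 0 := map_zero g
  have hs' : IsOpen (g ⁻¹' s) := hs.preimage g.continuous
  have key := g.iteratedFDerivWithin_comp_right (contDiffOn_of_differentiableOn_complex hf hs m)
    hs.uniqueDiffOn hs'.uniqueDiffOn (x := 0) (by rwa [hg]) le_rfl
  rw [iteratedFDerivWithin_of_isOpen m hs (by rwa [hg]), iteratedFDerivWithin_of_isOpen m hs'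
    (by rwa [mem_preimage, hg]), hg] at key
  have h2 : (f ∘ g) = fun t : ℂ => f (t • z) := rfl
  rw [h2] at key
  rw [iteratedDeriv_eq_iteratedFDeriv, key, ContinuousMultilinearMap.compContinuousLinearMap_apply]
  simp [g]

/-- Only diagonal values of Taylor terms matter, and these are one-variable Taylor coefficients
along complex lines; the estimates and the convergence below come from this. -/
theorem taylorTerm_apply_eq {f : E → F} {s : Set E} (hf : DifferentiableOn ℂ f s)
    (hs : IsOpen s) (h0 : (0 : E) ∈ s) (m : ℕ) (z : E) :
    taylorTerm m f (fun _ => z) =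
      (m.factorial : ℂ)⁻¹ • iteratedDeriv m (fun t : ℂ => f (t • z)) 0 := by
  rw [iteratedDeriv_line_eq hf hs h0]; rfl

theorem norm_taylorTerm_le {f : E → F} {r M : ℝ} (hr : 0 < r)
    (hf : DifferentiableOn ℂ f (ball 0 r)) (hM : ∀ y ∈ ball (0 : E) r, ‖f y‖ ≤ M)
    (m : ℕ) (z : E) : ‖taylorTerm m f (fun _ => z)‖ ≤ M * (2 / r * ‖z‖) ^ m := by
  have : CompleteSpace F := FiniteDimensional.complete ℂ F
  have h0 : (0 : E) ∈ ball (0 : E) r := mem_ball_self hr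
  rcases eq_or_ne z 0 with rfl | hz
  · rcases m with _ | m
    · simpa [taylorTerm_zero] using hM 0 h0
    · rw [(taylorTerm (m + 1) f).map_coord_zero 0 rfl]
      simp
  have hz' : 0 < ‖z‖ := norm_pos_iff.2 hz
  have hmem : ∀ t : ℂ, ‖t‖ ≤ r / (2 * ‖z‖) → t • z ∈ ball (0 : E) r := by
    intro t ht
    rw [mem_ball_zero_iff, norm_smul]
    rw [le_div_iff₀ (by positivity)] at ht
    nlinarith [norm_nonneg t]
  have key := Complex.norm_iteratedDeriv_le_of_forall_mem_sphere_norm_le (c := 0)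
    (R := r / (2 * ‖z‖)) (C := M) (f := fun t : ℂ => f (t • z)) m (by positivity) ?_ ?_
  · rw [taylorTerm_apply_eq hf isOpen_ball h0, norm_smul, norm_inv, Complex.norm_natCast]
    have hfac : (0 : ℝ) < m.factorial := by positivity
    rw [inv_mul_le_iff₀ hfac]
    refine key.trans (le_of_eq ?_)
    rw [mul_div_assoc, div_eq_mul_inv M, ← inv_pow, inv_div, mul_div_right_comm]
  · refine DifferentiableOn.diffContOnCl_ball (U := (fun t : ℂ => t • z) ⁻¹' ball 0 r)
      (hf.comp (by fun_prop) fun _ h => h) fun t ht => hmem t (by simpa using ht)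
  · intro t ht
    exact hM _ (hmem t (by simpa using ht.le))

theorem hasSum_taylorTerm {f : E → F} {r : ℝ} (hf : DifferentiableOn ℂ f (ball 0 r))
    {z : E} (hz : z ∈ ball (0 : E) r) : HasSum (fun m => taylorTerm m f fun _ => z) (f z) := by
  have : CompleteSpace F := FiniteDimensional.complete ℂ F
  rw [mem_ball_zero_iff] at hz
  have hr : 0 < r := (norm_nonneg z).trans_lt hz
  -- The disc of radius `R > 1` contains the parameter 1, where the one-variable series along the
  -- line through `z` is evaluated.
  obtain ⟨R, hR1, hR⟩ : ∃ R : ℝ, 1 < R ∧ R * ‖z‖ ≤ r := by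
    rcases eq_or_ne z 0 with rfl | hz0
    · exact ⟨2, by norm_num, by simpa using hr.le⟩
    · have hz' : 0 < ‖z‖ := norm_pos_iff.2 hz0
      exact ⟨r / ‖z‖, by rwa [lt_div_iff₀ hz', one_mul], by rw [div_mul_cancel₀ _ hz'.ne']⟩
  have hd : DifferentiableOn ℂ (fun t : ℂ => f (t • z)) (ball 0 R) := by
    refine hf.comp (by fun_prop) fun t ht => ?_
    rw [mem_ball_zero_iff] at ht ⊢
    rw [norm_smul]
    rcases eq_or_ne z 0 with rfl | hz0
    · simpa using hr
    · exact (mul_lt_mul_of_pos_right ht (norm_pos_iff.2 hz0)).trans_le hR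
  have key := Complex.hasSum_taylorSeries_on_ball hd (z := 1) (by simpa using hR1)
  simp only [sub_zero, one_pow, one_smul] at key
  simpa only [taylorTerm_apply_eq hf isOpen_ball (mem_ball_self hr)] using key

/-- For `z` near 0 Cauchy's estimates dominate the series by a geometric one of ratio at most 1/2,
so the tail starting at degree m + 1 is bounded by twice its first term. -/
theorem isBigO_sub_taylorTerm {f : E → F} {s : Set E} (hf : DifferentiableOn ℂ f s)
    (hs : IsOpen s) (h0 : (0 : E) ∈ s) {m : ℕ} (hm : 2 ≤ m) (hf0 : f 0 = 0)
    (hvanish : ∀ j, 2 ≤ j → j < m → ∀ z, taylorTerm j f (fun _ => z) = 0) :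
    (fun z => f z - fderiv ℂ f 0 z - taylorTerm m f fun _ => z) =O[𝓝 0] fun z => ‖z‖ ^ (m + 1) := by
  obtain ⟨r, hr, hrs⟩ := Metric.isOpen_iff.1 hs 0 h0
  have hcont : ContinuousAt f 0 := hf.continuousOn.continuousAt (hs.mem_nhds h0)
  obtain ⟨r', hr', hr'1⟩ := Metric.continuousAt_iff.1 hcont 1 one_pos
  let δ := min r r'
  have hδ : 0 < δ := lt_min hr hr'
  have hfδ : DifferentiableOn ℂ f (ball 0 δ) :=
    hf.mono ((ball_subset_ball (min_le_left _ _)).trans hrs)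
  have hM : ∀ y ∈ ball (0 : E) δ, ‖f y‖ ≤ 1 := by
    intro y hy
    have := hr'1 (lt_of_lt_of_le hy (min_le_right _ _))
    rw [hf0, dist_zero_right] at this
    exact this.le
  refine Asymptotics.IsBigO.of_bound (2 * (2 / δ) ^ (m + 1)) ?_
  filter_upwards [ball_mem_nhds (0 : E) (show 0 < δ / 4 by positivity)] with z hz
  rw [mem_ball_zero_iff] at hz
  have hx : 2 / δ * ‖z‖ ≤ 1 / 2 := by
    rw [div_mul_eq_mul_div, div_le_iff₀ hδ]; linarith
  have hsum := hasSum_taylorTerm hfδ (z := z) (by rw [mem_ball_zero_iff]; linarith)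
  have key := norm_sub_le_of_geometric_bound_of_hasSum (by linarith)
    (fun j => norm_taylorTerm_le hδ hfδ hM j z) hsum (m + 1)
  have hfin : ∑ j ∈ Finset.range (m + 1), taylorTerm j f (fun _ => z) =
      fderiv ℂ f 0 z + taylorTerm m f fun _ => z := by
    rw [Finset.sum_range_succ]
    congr 1
    rw [Finset.sum_eq_single_of_mem 1 (Finset.mem_range.2 (by omega)), taylorTerm_one]
    intro j hj hj1
    rcases j with _ | j
    · rw [taylorTerm_zero, hf0]
    · exact hvanish _ (by omega) (Finset.mem_range.1 hj) z
  rw [hfin, norm_sub_rev, ← sub_sub] at key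
  refine key.trans ?_
  rw [one_mul, mul_pow, norm_pow, norm_norm, div_le_iff₀ (by linarith)]
  have : 0 ≤ (2 / δ) ^ (m + 1) * ‖z‖ ^ (m + 1) := by positivity
  nlinarith

/-- If all Taylor terms at the origin of degree at least two of `f` vanish then `f` is linear. -/
theorem eqOn_fderiv_of_taylorTerm_eq_zero {f : E → F} {s : Set E} (hf : DifferentiableOn ℂ f s)
    (hs : IsOpen s) (hconn : IsPreconnected s) (h0 : (0 : E) ∈ s) (hf0 : f 0 = 0)
    (hvanish : ∀ j, 2 ≤ j → ∀ z, taylorTerm j f (fun _ => z) = 0) :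
    ∀ z ∈ s, f z = fderiv ℂ f 0 z := by
  let h : E → F := fun z => f z - fderiv ℂ f 0 z
  have hh : DifferentiableOn ℂ h s := hf.sub (fderiv ℂ f 0).differentiable.differentiableOn
  suffices H : s ⊆ {z | ∀ᶠ y in 𝓝 z, h y = 0} from fun z hz => sub_eq_zero.1 (H hz).self_of_nhds
  -- Identity theorem: the set where the difference vanishes locally is open, contains 0 and is
  -- relatively closed in `s`.
  refine hconn.subset_of_closure_inter_subset isOpen_setOfPred_eventually_nhds ⟨0, h0, ?_⟩ ?_
  · obtain ⟨r, hr, hrs⟩ := Metric.isOpen_iff.1 hs 0 h0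
    refine eventually_of_mem (ball_mem_nhds 0 hr) fun z hz => sub_eq_zero.2 ?_
    have h1 : HasSum (fun m => taylorTerm m f fun _ => z) (taylorTerm 1 f fun _ => z) := by
      refine hasSum_single 1 fun j hj => ?_
      rcases j with _ | j
      · rw [taylorTerm_zero, hf0]
      · exact hvanish _ (by omega) z
    rw [(hasSum_taylorTerm (hf.mono hrs) hz).unique h1, taylorTerm_one]
  · rintro x ⟨hxu, hxs⟩
    obtain ⟨ε, hε, hεs⟩ := Metric.isOpen_iff.1 hs x hxs
    obtain ⟨y, hy, hxy⟩ := Metric.mem_closure_iff.1 hxu (ε / 2) (by positivity)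
    have hball : ball y (ε / 2) ⊆ s := by
      refine Subset.trans (ball_subset_ball' ?_) hεs
      rw [dist_comm]; linarith
    have hd : DifferentiableOn ℂ (fun v => h (v + y)) (ball 0 (ε / 2)) := by
      refine hh.comp (by fun_prop) fun v hv => hball ?_
      simpa using hv
    have hev : (fun v => h (v + y)) =ᶠ[𝓝 0] fun _ => 0 := by
      have hc : Tendsto (fun v : E => v + y) (𝓝 0) (𝓝 y) := by
        simpa using (continuous_add_const y).tendsto 0
      exact hc.eventually hy
    refine eventually_of_mem (isOpen_ball.mem_nhds (show x ∈ ball y (ε / 2) from hxy))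
      fun z hz => ?_
    have hsum := hasSum_taylorTerm hd (z := z - y) (by simpa [dist_eq_norm] using hz)
    have h2 : ∀ m, taylorTerm m (fun v => h (v + y)) (fun _ => z - y) = 0 := by
      intro m
      rw [taylorTerm, (hev.iteratedFDeriv ℂ m).self_of_nhds]
      simp
    simp only [h2, sub_add_cancel] at hsum
    exact hsum.unique hasSum_zero

end SeveralVariables

namespace QuasiReinhardt

/-! ### Homogeneous polynomials attached to multilinear forms. -/

section DiagonalPolynomial

variable {n m : ℕ}

/-- The polynomial `z ↦ w(z, …, z)` attached to an `m`-linear form `w` on `ℂⁿ`. -/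
noncomputable def diagonalPolynomial (w : MultilinearMap ℂ (fun _ : Fin m => Fin n → ℂ) ℂ) :
    MvPolynomial (Fin n) ℂ :=
  ∑ s : Fin m → Fin n, MvPolynomial.C (w fun j => Pi.single (s j) 1) *
    ∏ j, MvPolynomial.X (s j)

theorem eval_diagonalPolynomial (w : MultilinearMap ℂ (fun _ : Fin m => Fin n → ℂ) ℂ)
    (z : Fin n → ℂ) : MvPolynomial.eval z (diagonalPolynomial w) = w fun _ => z := by
  have hz : (fun _ : Fin m => z) = fun _ => ∑ i, z i • (Pi.single i 1 : Fin n → ℂ) := by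
    funext _
    ext i
    simp [Finset.sum_apply, Pi.single_apply]
  conv_rhs => rw [hz, MultilinearMap.map_sum]
  simp only [MultilinearMap.map_smul_univ, diagonalPolynomial, map_sum, map_mul, map_prod,
    MvPolynomial.eval_C, MvPolynomial.eval_X, smul_eq_mul]
  exact Finset.sum_congr rfl fun s _ => mul_comm _ _

theorem isHomogeneous_diagonalPolynomial
    (w : MultilinearMap ℂ (fun _ : Fin m => Fin n → ℂ) ℂ) :
    (diagonalPolynomial w).IsHomogeneous m := by
  refine MvPolynomial.IsHomogeneous.sum _ _ _ fun s _ => ?_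
  have h := MvPolynomial.IsHomogeneous.prod (R := ℂ) Finset.univ
    (fun j : Fin m => MvPolynomial.X (s j)) (fun _ => 1) fun j _ => MvPolynomial.isHomogeneous_X _ _
  simpa using (MvPolynomial.isHomogeneous_C (Fin n) (w fun j => Pi.single (s j) 1)).mul h

/-- The finite set of points of `ℂⁿ` all of whose coordinates are in `{0, …, m}`. -/
noncomputable def grid (m n : ℕ) : Finset (Fin n → ℂ) :=
  Fintype.piFinset fun _ => (Finset.range (m + 1)).image (Nat.cast : ℕ → ℂ)

/-- A polynomial of degree at most m in each variable is determined by m + 1 values per coordinate.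
Finitely many evaluations thus give a norm on homogeneous maps of degree m. -/
theorem eq_zero_of_forall_mem_grid (w : MultilinearMap ℂ (fun _ : Fin m => Fin n → ℂ) ℂ)
    (h : ∀ z ∈ grid m n, w (fun _ => z) = 0) (z : Fin n → ℂ) : w (fun _ => z) = 0 := by
  rw [← eval_diagonalPolynomial, MvPolynomial.eq_zero_of_eval_zero_at_prod_finset
    (diagonalPolynomial w) (fun _ => (Finset.range (m + 1)).image (Nat.cast : ℕ → ℂ)), map_zero]
  · intro i
    rw [Finset.card_image_of_injective _ Nat.cast_injective, Finset.card_range, Nat.lt_succ_iff]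
    exact (MvPolynomial.degreeOf_le_totalDegree _ _).trans
      (isHomogeneous_diagonalPolynomial w).totalDegree_le
  · intro x hx
    rw [eval_diagonalPolynomial]
    exact h x (Fintype.mem_piFinset.2 hx)

end DiagonalPolynomial

/-! ### Fourier analysis on the torus, weights and absence of resonances. -/

section Torus

variable {r : ℕ}

/-- The parametrisation of `T^r` by `(ℝ/ℤ)^r`. -/
noncomputable def toTorus (x : Fin r → UnitAddCircle) : Torus r := fun j => AddCircle.toCircle (x j)

theorem toTorus_add (x y : Fin r → UnitAddCircle) : toTorus (x + y) = toTorus x * toTorus y := by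
  funext j
  simp [toTorus, AddCircle.toCircle_add]

theorem toTorus_zero : toTorus (0 : Fin r → UnitAddCircle) = 1 := by
  funext j
  simp [toTorus]

theorem continuous_toTorus : Continuous (toTorus : (Fin r → UnitAddCircle) → Torus r) :=
  continuous_pi fun j => AddCircle.continuous_toCircle.comp (continuous_apply j)

theorem toTorus_surjective : Function.Surjective (toTorus : (Fin r → UnitAddCircle) → Torus r) := by
  intro t
  refine ⟨fun j => (AddCircle.homeomorphCircle one_ne_zero).symm (t j), ?_⟩
  funext j
  rw [toTorus, ← AddCircle.homeomorphCircle_apply one_ne_zero, Homeomorph.apply_symm_apply]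

theorem mFourier_eq_character (k : Fin r → ℤ) (x : Fin r → UnitAddCircle) :
    UnitAddTorus.mFourier k x = character k (toTorus x) := by
  simp [UnitAddTorus.mFourier, character, toTorus, fourier_apply, AddCircle.toCircle_zsmul]

theorem character_mul (k : Fin r → ℤ) (s t : Torus r) :
    character k (s * t) = character k s * character k t := by
  simp [character, mul_zpow, Finset.prod_mul_distrib]

theorem character_neg_mul (k : Fin r → ℤ) (t : Torus r) :
    character (-k) t * character k t = 1 := by
  rw [character, character, ← Finset.prod_mul_distrib]
  refine Finset.prod_eq_one fun j _ => ?_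
  rw [Pi.neg_apply, zpow_neg, inv_mul_cancel₀ (zpow_ne_zero _ (Circle.coe_ne_zero _))]

/-- The normalised Haar measure on `(ℝ/ℤ)^r`. -/
noncomputable abbrev torusMeasure (r : ℕ) : Measure (Fin r → UnitAddCircle) :=
  Measure.pi fun _ => AddCircle.haarAddCircle

theorem integrable_torusMeasure {V : Type*} [NormedAddCommGroup V]
    {f : (Fin r → UnitAddCircle) → V} (hf : Continuous f) : Integrable f (torusMeasure r) :=
  hf.integrable_of_hasCompactSupport (HasCompactSupport.of_compactSpace f)

/-- A continuous function on the torus all of whose Fourier coefficients are zero vanishes. -/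
theorem eq_zero_of_forall_integral_mFourier_eq_zero {f : (Fin r → UnitAddCircle) → ℂ}
    (hf : Continuous f)
    (h : ∀ k : Fin r → ℤ, ∫ x, UnitAddTorus.mFourier k x * f x ∂torusMeasure r = 0)
    (x : Fin r → UnitAddCircle) : f x = 0 := by
  obtain ⟨C, hC⟩ := isCompact_univ.exists_bound_of_continuousOn hf.continuousOn
  have hC0 : 0 ≤ C := (norm_nonneg _).trans (hC x (mem_univ x))
  let Φ : C(UnitAddTorus (Fin r), ℂ) →ₗ[ℂ] ℂ :=
    { toFun := fun g => ∫ x, g x * f x ∂torusMeasure r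
      map_add' := fun g₁ g₂ => by
        simp only [ContinuousMap.add_apply, add_mul]
        exact integral_add (integrable_torusMeasure (g₁.continuous.mul hf))
          (integrable_torusMeasure (g₂.continuous.mul hf))
      map_smul' := fun c g => by
        simp only [ContinuousMap.smul_apply, smul_eq_mul, mul_assoc, RingHom.id_apply]
        exact integral_const_mul _ _ }
  let Ψ : C(UnitAddTorus (Fin r), ℂ) →L[ℂ] ℂ := Φ.mkContinuous C fun g => by
    have := norm_integral_le_of_norm_le_const (μ := torusMeasure r) (C := C * ‖g‖)
      (f := fun x => g x * f x) (Eventually.of_forall fun x => by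
        rw [norm_mul, mul_comm]
        exact mul_le_mul (hC x (mem_univ x)) (g.norm_coe_le_norm x) (norm_nonneg _) hC0)
    rw [probReal_univ, mul_one] at this
    exact this
  have hker : (⊤ : Submodule ℂ C(UnitAddTorus (Fin r), ℂ)) ≤ LinearMap.ker Ψ.toLinearMap := by
    rw [← UnitAddTorus.span_mFourier_closure_eq_top]
    refine Submodule.topologicalClosure_minimal _ ?_ Ψ.isClosed_ker
    rw [Submodule.span_le]
    rintro _ ⟨k, rfl⟩
    exact h k
  -- The functional vanishes on the dense span of the characters, hence everywhere; its value at the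
  -- conjugate of `f` is the squared L² norm.
  have hint : ∫ x, star (f x) * f x ∂torusMeasure r = 0 :=
    hker (x := ⟨fun x => star (f x), continuous_star.comp hf⟩) trivial
  have hcast : ∀ x, star (f x) * f x = ((‖f x‖ ^ 2 : ℝ) : ℂ) := fun x => by
    rw [Complex.star_def, Complex.conj_mul', Complex.ofReal_pow]
  simp only [hcast] at hint
  rw [integral_complex_ofReal, Complex.ofReal_eq_zero, integral_eq_zero_iff_of_nonneg
    (fun x => by positivity) (integrable_torusMeasure (by fun_prop))] at hint
  have := (Continuous.ae_eq_iff_eq (torusMeasure r) (by fun_prop) continuous_const).1 hint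
  have hx : ‖f x‖ ^ 2 = 0 := congrFun this x
  simpa using hx

variable {n : ℕ} (ρ : Torus r →* Matrix.GeneralLinearGroup (Fin n) ℂ)

/-- The action of the torus on `ℂⁿ`, as a family of continuous linear maps. -/
noncomputable def rep (x : Fin r → UnitAddCircle) : (Fin n → ℂ) →L[ℂ] (Fin n → ℂ) :=
  LinearMap.toContinuousLinearMap
    (Matrix.mulVecLin (ρ (toTorus x) : Matrix (Fin n) (Fin n) ℂ))

theorem rep_apply (x : Fin r → UnitAddCircle) (z : Fin n → ℂ) :
    rep ρ x z = act ρ (toTorus x) z := rfl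

theorem rep_add_apply (x y : Fin r → UnitAddCircle) (z : Fin n → ℂ) :
    rep ρ (x + y) z = rep ρ x (rep ρ y z) := by
  simp [rep_apply, act, toTorus_add]

theorem rep_zero_apply (z : Fin n → ℂ) : rep ρ 0 z = z := by
  simp [rep_apply, act, toTorus_zero]

theorem rep_neg_apply_rep (x : Fin r → UnitAddCircle) (z : Fin n → ℂ) :
    rep ρ (-x) (rep ρ x z) = z := by
  rw [← rep_add_apply, neg_add_cancel, rep_zero_apply]

theorem rep_apply_rep_neg (x : Fin r → UnitAddCircle) (z : Fin n → ℂ) :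
    rep ρ x (rep ρ (-x) z) = z := by
  rw [← rep_add_apply, add_neg_cancel, rep_zero_apply]

variable {ρ}

theorem continuous_rep (hρ : Continuous ρ) : Continuous (rep ρ) := by
  let T : Matrix (Fin n) (Fin n) ℂ →ₗ[ℂ] (Fin n → ℂ) →L[ℂ] (Fin n → ℂ) :=
    LinearMap.toContinuousLinearMap.toLinearMap ∘ₗ
      (Matrix.toLin' : Matrix (Fin n) (Fin n) ℂ ≃ₗ[ℂ] _).toLinearMap
  have hT : Continuous T := LinearMap.continuous_of_finiteDimensional T
  exact hT.comp (Units.continuous_val.comp (hρ.comp continuous_toTorus))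

theorem continuous_rep_apply (hρ : Continuous ρ) (z : Fin n → ℂ) : Continuous fun x => rep ρ x z :=
  (continuous_rep hρ).clm_apply continuous_const

/-- The linear forms that are eigenvectors for the action of the torus separate points. -/
theorem exists_eigenform (hρ : Continuous ρ) {v : Fin n → ℂ} (hv : v ≠ 0) :
    ∃ (k : Fin r → ℤ) (l : (Fin n → ℂ) →ₗ[ℂ] ℂ),
      (∀ t z, l (act ρ t z) = character k t * l z) ∧ l v ≠ 0 := by
  obtain ⟨i, hi⟩ := Function.ne_iff.1 hv
  have hcont : ∀ z, Continuous fun x => rep ρ x z i := fun z =>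
    (continuous_apply i).comp (continuous_rep_apply hρ z)
  obtain ⟨k, hk⟩ : ∃ k : Fin r → ℤ,
      ∫ x, UnitAddTorus.mFourier k x * rep ρ x v i ∂torusMeasure r ≠ 0 := by
    by_contra! h
    have := eq_zero_of_forall_integral_mFourier_eq_zero (hcont v) h 0
    rw [rep_zero_apply] at this
    exact hi this
  have hint : ∀ z, Integrable (fun x => UnitAddTorus.mFourier k x * rep ρ x z i)
      (torusMeasure r) := fun z =>
    integrable_torusMeasure ((UnitAddTorus.mFourier k).continuous.mul (hcont z))
  let l : (Fin n → ℂ) →ₗ[ℂ] ℂ :=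
    { toFun := fun z => ∫ x, UnitAddTorus.mFourier k x * rep ρ x z i ∂torusMeasure r
      map_add' := fun z w => by
        simp only [map_add, Pi.add_apply, mul_add]
        exact integral_add (hint z) (hint w)
      map_smul' := fun c z => by
        simp only [map_smul, Pi.smul_apply, smul_eq_mul, RingHom.id_apply, mul_left_comm _ c]
        exact integral_const_mul _ _ }
  -- Integrating against the character `k` itself, not its conjugate, isolates the weight `-k`.
  refine ⟨-k, l, fun t z => ?_, hk⟩
  obtain ⟨y, rfl⟩ := toTorus_surjective t
  change ∫ x, UnitAddTorus.mFourier k x * rep ρ x (rep ρ y z) i ∂torusMeasure r =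
    _ * ∫ x, UnitAddTorus.mFourier k x * rep ρ x z i ∂torusMeasure r
  rw [← integral_add_right_eq_self (fun x => UnitAddTorus.mFourier k x * rep ρ x z i) y,
    ← integral_const_mul]
  refine integral_congr_ae (Eventually.of_forall fun x => ?_)
  simp only [← rep_add_apply, mFourier_eq_character, toTorus_add, character_mul]
  linear_combination -(character k (toTorus x) * rep ρ (x + y) z i) *
    character_neg_mul k (toTorus y)

/-- The form `l` gives an element of degree at most 1 in the weight space. A nonzero constant there
would force the character to be trivial, so `l` would be invariant, hence constant, hence zero. So
the minimal degree is exactly 1 and the resonance order bounds all degrees of this weight. -/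
theorem totalDegree_le_one_of_mem_weightSpace (hinv : InvariantsConstant ρ)
    (hμ : resonanceOrder ρ = 1) {k : Fin r → ℤ} {l : (Fin n → ℂ) →ₗ[ℂ] ℂ}
    (hl : ∀ t z, l (act ρ t z) = character k t * l z) (hl0 : l ≠ 0)
    {p : MvPolynomial (Fin n) ℂ} (hp : p ∈ weightSpace ρ k) : p.totalDegree ≤ 1 := by
  let q : MvPolynomial (Fin n) ℂ :=
    diagonalPolynomial (MultilinearMap.ofSubsingleton ℂ (Fin n → ℂ) ℂ (0 : Fin 1) l)
  have hq : ∀ z, MvPolynomial.eval z q = l z := fun z => by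
    simp [q, eval_diagonalPolynomial]
  have hqk : q ∈ weightSpace ρ k := fun t z => by rw [hq, hq, hl]
  have hq0 : q ≠ 0 := by
    intro h
    refine hl0 (LinearMap.ext fun z => ?_)
    rw [← hq, h, map_zero, LinearMap.zero_apply]
  have hq1 : q.totalDegree ≤ 1 := (isHomogeneous_diagonalPolynomial _).totalDegree_le
  have hmin : minDegree ρ k = 1 := by
    refine le_antisymm ?_ ?_
    · exact (iInf₂_le q ⟨hqk, hq0⟩).trans (by exact_mod_cast hq1)
    · refine le_iInf₂ fun p' hp' => ?_
      rw [Order.one_le_iff_ne_zero]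
      intro h0
      have h0' : p'.totalDegree = 0 := by exact_mod_cast h0
      rw [MvPolynomial.totalDegree_eq_zero_iff_eq_C] at h0'
      obtain ⟨hmem, hne⟩ := hp'
      rw [h0'] at hmem hne
      have hc : p'.coeff 0 ≠ 0 := fun h => hne (by rw [h, map_zero])
      have hchar : ∀ t, character k t = 1 := by
        intro t
        have := hmem t 0
        rw [MvPolynomial.eval_C, MvPolynomial.eval_C] at this
        exact (mul_eq_right₀ hc).1 this.symm
      obtain ⟨c, hlc⟩ := hinv l (LinearMap.toContinuousLinearMap l).differentiable
        fun t z => by rw [hl, hchar, one_mul]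
      refine hl0 (LinearMap.ext fun z => ?_)
      rw [hlc, ← hlc 0, map_zero, LinearMap.zero_apply]
  have h1 : (p.totalDegree : ℕ∞) ≤ 1 := by
    rw [← hμ]
    exact (le_iSup₂ (f := fun p (_ : p ∈ weightSpace ρ k) => (p.totalDegree : ℕ∞)) p hp).trans
      (le_iSup₂ (f := fun k (_ : k ∈ {k | minDegree ρ k = 1}) => maxDegree ρ k) k hmin)
  exact_mod_cast h1

/-- Absence of resonances: there are no equivariant homogeneous polynomial maps of degree at
least two. -/
theorem equivariant_multilinear_apply_eq_zero (hρ : Continuous ρ) (hinv : InvariantsConstant ρ)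
    (hμ : resonanceOrder ρ = 1) {m : ℕ} (hm : 2 ≤ m)
    (Q : MultilinearMap ℂ (fun _ : Fin m => Fin n → ℂ) (Fin n → ℂ))
    (hQ : ∀ t z, Q (fun _ => act ρ t z) = act ρ t (Q fun _ => z)) (z : Fin n → ℂ) :
    Q (fun _ => z) = 0 := by
  by_contra hne
  obtain ⟨k, l, hl, hlz⟩ := exists_eigenform hρ hne
  have hl0 : l ≠ 0 := by
    rintro rfl
    exact hlz rfl
  have heval : ∀ z, MvPolynomial.eval z (diagonalPolynomial (l.compMultilinearMap Q)) =
      l (Q fun _ => z) := fun z => by rw [eval_diagonalPolynomial]; rfl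
  have hp : diagonalPolynomial (l.compMultilinearMap Q) ∈ weightSpace ρ k := fun t z => by
    rw [heval, heval, hQ, hl]
  have hp0 : diagonalPolynomial (l.compMultilinearMap Q) ≠ 0 := by
    intro h
    rw [← heval, h, map_zero] at hlz
    exact hlz rfl
  have h1 := totalDegree_le_one_of_mem_weightSpace hinv hμ hl hl0 hp
  rw [(isHomogeneous_diagonalPolynomial _).totalDegree hp0] at h1
  omega

/-- Translation invariance of Haar measure makes the mean of the conjugates of `w` equivariant, so
the absence of resonances applies. Integrating in the space of multilinear maps shows that the mean
is again multilinear. -/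
theorem integral_rep_neg_comp_rep_eq_zero (hρ : Continuous ρ) (hinv : InvariantsConstant ρ)
    (hμ : resonanceOrder ρ = 1) {m : ℕ} (hm : 2 ≤ m)
    (w : (Fin n → ℂ) [×m]→L[ℂ] (Fin n → ℂ)) (z : Fin n → ℂ) :
    ∫ x, rep ρ (-x) (w fun _ => rep ρ x z) ∂torusMeasure r = 0 := by
  let tw : (Fin r → UnitAddCircle) → (Fin n → ℂ) [×m]→L[ℂ] (Fin n → ℂ) := fun x =>
    (rep ρ (-x)).compContinuousMultilinearMap (w.compContinuousLinearMap fun _ => rep ρ x)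
  have htw : Continuous tw := by
    have h1 : Continuous fun x => w.compContinuousLinearMap fun _ => rep ρ x :=
      (ContinuousMultilinearMap.compContinuousLinearMapContinuousMultilinear ℂ
        (fun _ : Fin m => Fin n → ℂ) (fun _ : Fin m => Fin n → ℂ) (Fin n → ℂ)).cont.clm_apply
          continuous_const |>.comp (continuous_pi fun _ => continuous_rep hρ)
    exact ((ContinuousLinearMap.compContinuousMultilinearMapL ℂ (fun _ : Fin m => Fin n → ℂ)
      (Fin n → ℂ) (Fin n → ℂ)).continuous.comp
        ((continuous_rep hρ).comp continuous_neg)).clm_apply h1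
  have happ : ∀ z, (∫ x, tw x ∂torusMeasure r) (fun _ => z) =
      ∫ x, rep ρ (-x) (w fun _ => rep ρ x z) ∂torusMeasure r := fun z =>
    ((ContinuousMultilinearMap.apply ℂ (fun _ : Fin m => Fin n → ℂ) (Fin n → ℂ)
      fun _ => z).integral_comp_comm (integrable_torusMeasure htw)).symm
  rw [← happ]
  refine equivariant_multilinear_apply_eq_zero hρ hinv hμ hm
    (∫ x, tw x ∂torusMeasure r).toMultilinearMap (fun t z => ?_) z
  obtain ⟨y, rfl⟩ := toTorus_surjective t
  change (∫ x, tw x ∂torusMeasure r) (fun _ => rep ρ y z) =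
    rep ρ y ((∫ x, tw x ∂torusMeasure r) fun _ => z)
  have hint : Continuous fun x => rep ρ (-x) (w fun _ => rep ρ x z) :=
    ((continuous_rep hρ).comp continuous_neg).clm_apply
      (w.cont.comp (continuous_pi fun _ => continuous_rep_apply hρ z))
  rw [happ, happ, ← (rep ρ y).integral_comp_comm (integrable_torusMeasure hint),
    ← integral_add_right_eq_self (fun x => rep ρ y (rep ρ (-x) (w fun _ => rep ρ x z))) y]
  refine integral_congr_ae (Eventually.of_forall fun x => ?_)
  simp only [← rep_add_apply]
  rw [neg_add, add_neg_cancel_comm_assoc]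

end Torus

end QuasiReinhardt

/-! ### Leading nonlinear term of a composition. -/

section Jets

theorem isBigO_norm_pow_of_le {V : Type*} [NormedAddCommGroup V] {a b : ℕ} (h : a ≤ b) :
    (fun z : V => ‖z‖ ^ b) =O[𝓝 0] fun z => ‖z‖ ^ a := by
  refine Asymptotics.IsBigO.of_bound 1 ?_
  filter_upwards [ball_mem_nhds (0 : V) one_pos] with z hz
  rw [mem_ball_zero_iff] at hz
  rw [one_mul, norm_pow, norm_pow, norm_norm]
  exact pow_le_pow_of_le_one (norm_nonneg z) hz.le h

variable {E : Type*} [NormedAddCommGroup E] [NormedSpace ℂ E]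

theorem isBigO_multilinear_diagonal {m : ℕ} (w : E [×m]→L[ℂ] E) :
    (fun z => w fun _ => z) =O[𝓝 0] fun z => ‖z‖ ^ m :=
  Asymptotics.IsBigO.of_bound ‖w‖ (Eventually.of_forall fun z => by
    simpa using w.le_opNorm fun _ => z)

/-- The terms of order `m` in a composition of maps whose Taylor expansions have no terms of order
strictly between `1` and `m`. -/
theorem multilinear_diagonal_comp {k l : E → E} {A B : E →L[ℂ] E} {m : ℕ} (hm : 2 ≤ m)
    {w p q : E [×m]→L[ℂ] E} (hl0 : l 0 = 0) (hld : DifferentiableAt ℂ l 0)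
    (hk : (fun z => k z - A z - w fun _ => z) =O[𝓝 0] fun z => ‖z‖ ^ (m + 1))
    (hl : (fun z => l z - B z - p fun _ => z) =O[𝓝 0] fun z => ‖z‖ ^ (m + 1))
    (hkl : (fun z => k (l z) - A (B z) - q fun _ => z) =O[𝓝 0] fun z => ‖z‖ ^ (m + 1)) (z : E) :
    q (fun _ => z) = A (p fun _ => z) + w fun _ => B z := by
  have hlO : l =O[𝓝 0] fun z => ‖z‖ := by
    have := hld.isBigO_sub
    simpa only [hl0, sub_zero] using this.norm_right
  have hlt : Tendsto l (𝓝 0) (𝓝 0) := by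
    have := hld.continuousAt.tendsto
    rwa [hl0] at this
  have h1 : (fun z => k (l z) - A (l z) - w fun _ => l z) =O[𝓝 0] fun z => ‖z‖ ^ (m + 1) :=
    (hk.comp_tendsto hlt).trans (hlO.norm_left.pow (m + 1))
  have h2 : (fun z => A (l z - B z - p fun _ => z)) =O[𝓝 0] fun z => ‖z‖ ^ (m + 1) :=
    (A.isBigO_comp _ _).trans hl
  have hsub : (fun z => l z - B z) =O[𝓝 0] fun z => ‖z‖ ^ 2 := by
    have := (hl.trans (isBigO_norm_pow_of_le (show 2 ≤ m + 1 by omega))).add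
      ((isBigO_multilinear_diagonal p).trans (isBigO_norm_pow_of_le hm))
    simpa only [sub_add_cancel] using this
  have h3 : (fun z => (w fun _ => l z) - w fun _ => B z) =O[𝓝 0] fun z => ‖z‖ ^ (m + 1) := by
    have hBO : (fun z => B z) =O[𝓝 0] fun z => ‖z‖ := (B.isBigO_id _).norm_right
    have hmax : (fun z => max ‖l z‖ ‖B z‖) =O[𝓝 0] fun z => ‖z‖ := by
      refine (Asymptotics.IsBigO.of_bound 1 (Eventually.of_forall fun z => ?_)).trans
        (hlO.norm_left.add hBO.norm_left)
      rw [one_mul, Real.norm_of_nonneg (by positivity), Real.norm_of_nonneg (by positivity)]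
      exact max_le_add_of_nonneg (norm_nonneg _) (norm_nonneg _)
    have hprod : (fun z => max ‖l z‖ ‖B z‖ ^ (m - 1) * ‖l z - B z‖) =O[𝓝 0]
        fun z => ‖z‖ ^ (m + 1) := by
      have := (hmax.pow (m - 1)).mul hsub.norm_left
      simpa only [← pow_add, show m - 1 + 2 = m + 1 by omega] using this
    refine (Asymptotics.IsBigO.of_bound (‖w‖ * m) (Eventually.of_forall fun z => ?_)).trans hprod
    have := w.norm_image_sub_le (fun _ => l z) fun _ => B z
    have hc : ∀ v : E, ‖fun _ : Fin m => v‖ = ‖v‖ := fun v => by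
      have : Nonempty (Fin m) := ⟨⟨0, by omega⟩⟩
      exact pi_norm_const v
    rw [Fintype.card_fin, hc, hc, show ((fun _ : Fin m => l z) - fun _ => B z) =
      fun _ => l z - B z from rfl, hc] at this
    rw [Real.norm_of_nonneg (by positivity), ← mul_assoc]
    exact this
  -- A homogeneous map of degree m that is O(‖z‖^(m+1)) at 0 vanishes.
  have key : (fun z => (q - A.compContinuousMultilinearMap p -
      w.compContinuousLinearMap fun _ => B) fun _ => z) =O[𝓝 0] fun z => ‖z‖ ^ (m + 1) := by
    refine (((h1.add h2).add h3).sub hkl).congr_left fun z => ?_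
    simp only [map_sub, _root_.sub_apply,
      ContinuousMultilinearMap.compContinuousLinearMap_apply,
      ContinuousLinearMap.compContinuousMultilinearMap_coe, Function.comp_apply]
    abel
  have := key.continuousMultilinearMap_apply_eq_zero z
  simp only [_root_.sub_apply,
      ContinuousMultilinearMap.compContinuousLinearMap_apply,
      ContinuousLinearMap.compContinuousMultilinearMap_coe, Function.comp_apply] at this
  rwa [sub_sub, sub_eq_zero] at this

end Jets

namespace QuasiReinhardt

/-! ### A Euclidean energy on homogeneous maps. -/

section Energy

variable {n m : ℕ}

/-- The squared Euclidean norm of the values of a map on the grid `{0, …, m}ⁿ`. -/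
noncomputable def gridEnergy (m : ℕ) {n : ℕ} (p : (Fin n → ℂ) → Fin n → ℂ) : ℝ :=
  ∑ z ∈ grid m n, ∑ i, ‖p z i‖ ^ 2

theorem gridEnergy_add (p q : (Fin n → ℂ) → Fin n → ℂ) :
    gridEnergy m (fun z => p z + q z) = gridEnergy m p + gridEnergy m q +
      2 * ∑ z ∈ grid m n, ∑ i, (star (p z i) * q z i).re := by
  simp only [gridEnergy, Finset.mul_sum, ← Finset.sum_add_distrib]
  refine Finset.sum_congr rfl fun z _ => Finset.sum_congr rfl fun i _ => ?_
  simp only [Pi.add_apply, ← Complex.normSq_eq_norm_sq, Complex.normSq_apply, Complex.mul_re,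
    Complex.add_re, Complex.add_im, Complex.star_def, Complex.conj_re, Complex.conj_im]
  ring

/-- The energy is continuous and positive on the set of pairs of mutually inverse maps of norm at
most `C`. Keeping the inverse as a second bounded coordinate makes that set compact. -/
theorem exists_pos_le_gridEnergy (w : (Fin n → ℂ) [×m]→L[ℂ] (Fin n → ℂ))
    {z₀ : Fin n → ℂ} (hw : w (fun _ => z₀) ≠ 0) (C : ℝ) :
    ∃ c > 0, ∀ A B : (Fin n → ℂ) →L[ℂ] (Fin n → ℂ), ‖A‖ ≤ C → ‖B‖ ≤ C → A * B = 1 → B * A = 1 →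
      c ≤ gridEnergy m fun z => B (w fun _ => A z) := by
  let S : Set (((Fin n → ℂ) →L[ℂ] (Fin n → ℂ)) × ((Fin n → ℂ) →L[ℂ] (Fin n → ℂ))) :=
    (closedBall 0 C ×ˢ closedBall 0 C) ∩ {x | x.1 * x.2 = 1 ∧ x.2 * x.1 = 1}
  have : ProperSpace ((Fin n → ℂ) →L[ℂ] (Fin n → ℂ)) := FiniteDimensional.proper ℂ _
  have hS : IsCompact S := by
    refine ((isCompact_closedBall _ _).prod (isCompact_closedBall _ _)).inter_right ?_
    exact (isClosed_eq (by fun_prop) continuous_const).inter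
      (isClosed_eq (by fun_prop) continuous_const)
  let e : (((Fin n → ℂ) →L[ℂ] (Fin n → ℂ)) × ((Fin n → ℂ) →L[ℂ] (Fin n → ℂ))) → ℝ :=
    fun x => gridEnergy m fun z => x.2 (w fun _ => x.1 z)
  have he : Continuous e := by
    refine continuous_finsetSum _ fun z _ => continuous_finsetSum _ fun i _ => ?_
    refine (Continuous.norm ?_).pow 2
    refine (continuous_apply i).comp (continuous_snd.clm_apply (w.cont.comp ?_))
    exact continuous_pi fun _ => continuous_fst.clm_apply continuous_const
  have hpos : ∀ x ∈ S, 0 < e x := by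
    rintro ⟨A, B⟩ ⟨-, hAB, hBA⟩
    refine lt_of_le_of_ne (Finset.sum_nonneg fun _ _ => Finset.sum_nonneg fun _ _ => by positivity)
      fun h0 => hw ?_
    have h1 : ∀ z ∈ grid m n, ∀ i, B (w fun _ => A z) i = 0 := by
      intro z hz i
      have h2 := (Finset.sum_eq_zero_iff_of_nonneg fun _ _ => Finset.sum_nonneg
        fun _ _ => by positivity).1 h0.symm z hz
      have h3 := (Finset.sum_eq_zero_iff_of_nonneg fun _ _ => by positivity).1 h2 i
        (Finset.mem_univ i)
      simpa using h3
    have h4 : ∀ z i, B (w fun _ => A z) i = 0 := fun z i =>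
      eq_zero_of_forall_mem_grid ((LinearMap.proj i ∘ₗ B.toLinearMap).compMultilinearMap
        (w.toMultilinearMap.compLinearMap fun _ => A.toLinearMap)) (fun z hz => h1 z hz i) z
    -- Vanishing on the grid gives vanishing everywhere; evaluating at `B z₀` and applying `A`
    -- recovers `w` at `z₀`.
    have h5 : B (w fun _ => A (B z₀)) = 0 := funext fun i => h4 (B z₀) i
    have h6 : A (B z₀) = z₀ := by
      rw [← mul_apply_eq_comp, hAB]; rfl
    have h7 : A (B (w fun _ => A (B z₀))) = w fun _ => A (B z₀) := by
      rw [← mul_apply_eq_comp, hAB]; rfl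
    rw [h5, map_zero, h6] at h7
    exact h7.symm
  obtain ⟨c, hc, hcS⟩ := hS.exists_forall_le' he.continuousOn hpos
  refine ⟨c, hc, fun A B hA hB hAB hBA => hcS (A, B) ⟨⟨?_, ?_⟩, hAB, hBA⟩⟩ <;>
    simpa

end Energy

/-! ### Automorphisms fixing the origin and the growth argument. -/

section Isotropy

variable {n : ℕ} {D : Set (Fin n → ℂ)}

/-- The automorphisms of `D` that fix the origin. -/
def IsOriginAutomorphism (D : Set (Fin n → ℂ)) (f : (Fin n → ℂ) → (Fin n → ℂ)) : Prop :=
  IsAutomorphism D f ∧ f 0 = 0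

theorem IsOriginAutomorphism.comp {k l : (Fin n → ℂ) → (Fin n → ℂ)}
    (hk : IsOriginAutomorphism D k) (hl : IsOriginAutomorphism D l) :
    IsOriginAutomorphism D fun z => k (l z) := by
  obtain ⟨⟨hkd, hkm, k', hkd', hkm', hki⟩, hk0⟩ := hk
  obtain ⟨⟨hld, hlm, l', hld', hlm', hli⟩, hl0⟩ := hl
  exact ⟨⟨hkd.comp hld hlm, hkm.comp hlm, l' ∘ k', hld'.comp hkd' hkm', hlm'.comp hkm',
    hli.comp hki hlm hkm'⟩, by simp only [hl0, hk0]⟩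

theorem IsOriginAutomorphism.exists_inverse {k : (Fin n → ℂ) → (Fin n → ℂ)}
    (hk : IsOriginAutomorphism D k) (h0 : (0 : Fin n → ℂ) ∈ D) :
    ∃ g, IsOriginAutomorphism D g ∧ InvOn g k D D := by
  obtain ⟨⟨hkd, hkm, g, hgd, hgm, hi⟩, hk0⟩ := hk
  refine ⟨g, ⟨⟨hgd, hgm, k, hkd, hkm, hi.symm⟩, ?_⟩, hi⟩
  simpa [hk0] using hi.1 h0

theorem IsOriginAutomorphism.hasFDerivAt {k : (Fin n → ℂ) → (Fin n → ℂ)}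
    (hk : IsOriginAutomorphism D k) (hD : IsOpen D) (h0 : (0 : Fin n → ℂ) ∈ D) :
    HasFDerivAt k (fderiv ℂ k 0) 0 :=
  ((hk.1.1 0 h0).differentiableAt (hD.mem_nhds h0)).hasFDerivAt

theorem IsOriginAutomorphism.fderiv_comp {k l : (Fin n → ℂ) → (Fin n → ℂ)}
    (hk : IsOriginAutomorphism D k) (hl : IsOriginAutomorphism D l) (hD : IsOpen D)
    (h0 : (0 : Fin n → ℂ) ∈ D) :
    fderiv ℂ (fun z => k (l z)) 0 = fderiv ℂ k 0 * fderiv ℂ l 0 := by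
  have h1 := hk.hasFDerivAt hD h0
  rw [← hl.2] at h1
  have := (h1.comp 0 (hl.hasFDerivAt hD h0)).fderiv
  rw [hl.2] at this
  exact this

theorem IsOriginAutomorphism.fderiv_mul_of_leftInvOn {k g : (Fin n → ℂ) → (Fin n → ℂ)}
    (hk : IsOriginAutomorphism D k) (hg : IsOriginAutomorphism D g) (hD : IsOpen D)
    (h0 : (0 : Fin n → ℂ) ∈ D) (h : LeftInvOn g k D) : fderiv ℂ g 0 * fderiv ℂ k 0 = 1 := by
  rw [← hg.fderiv_comp hk hD h0]
  have : (fun z => g (k z)) =ᶠ[𝓝 0] id := eventually_of_mem (hD.mem_nhds h0) h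
  rw [this.fderiv_eq, fderiv_id]
  rfl

theorem IsQuasiReinhardt.isOriginAutomorphism_rep {r : ℕ}
    {ρ : Torus r →* Matrix.GeneralLinearGroup (Fin n) ℂ} (hD : IsQuasiReinhardt ρ D)
    (x : Fin r → UnitAddCircle) : IsOriginAutomorphism D (rep ρ x) :=
  ⟨⟨(rep ρ x).differentiable.differentiableOn, hD.invariant _, rep ρ (-x),
    (rep ρ (-x)).differentiable.differentiableOn, hD.invariant _,
    fun z _ => rep_neg_apply_rep ρ x z, fun z _ => rep_apply_rep_neg ρ x z⟩, map_zero _⟩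

/-- The Taylor expansions at the origin of all automorphisms fixing the origin have no terms of
degree at least `2` and less than `m`. -/
def TermsVanishBelow (D : Set (Fin n → ℂ)) (m : ℕ) : Prop :=
  ∀ k, IsOriginAutomorphism D k → ∀ j, 2 ≤ j → j < m → ∀ z, taylorTerm j k (fun _ => z) = 0

theorem TermsVanishBelow.isBigO {m : ℕ} (h : TermsVanishBelow D m) (hm : 2 ≤ m) (hD : IsOpen D)
    (h0 : (0 : Fin n → ℂ) ∈ D) {k : (Fin n → ℂ) → (Fin n → ℂ)} (hk : IsOriginAutomorphism D k) :
    (fun z => k z - fderiv ℂ k 0 z - taylorTerm m k fun _ => z) =O[𝓝 0] fun z => ‖z‖ ^ (m + 1) :=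
  isBigO_sub_taylorTerm hk.1.1 hD h0 hm hk.2 (h k hk)

theorem TermsVanishBelow.taylorTerm_comp {m : ℕ} (h : TermsVanishBelow D m) (hm : 2 ≤ m)
    (hD : IsOpen D) (h0 : (0 : Fin n → ℂ) ∈ D) {k l : (Fin n → ℂ) → (Fin n → ℂ)}
    (hk : IsOriginAutomorphism D k) (hl : IsOriginAutomorphism D l) (z : Fin n → ℂ) :
    taylorTerm m (fun z => k (l z)) (fun _ => z) =
      fderiv ℂ k 0 (taylorTerm m l fun _ => z) + taylorTerm m k fun _ => fderiv ℂ l 0 z := by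
  have hkl := h.isBigO hm hD h0 (hk.comp hl)
  rw [hk.fderiv_comp hl hD h0] at hkl
  exact multilinear_diagonal_comp hm hl.2 (hl.hasFDerivAt hD h0).differentiableAt
    (h.isBigO hm hD h0 hk) (h.isBigO hm hD h0 hl) hkl z

variable {r : ℕ} {ρ : Torus r →* Matrix.GeneralLinearGroup (Fin n) ℂ}

theorem TermsVanishBelow.taylorTerm_rep {m : ℕ} (h : TermsVanishBelow D m) (hm : 2 ≤ m)
    (hD : IsQuasiReinhardt ρ D) (h0 : (0 : Fin n → ℂ) ∈ D) (x : Fin r → UnitAddCircle)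
    (z : Fin n → ℂ) : taylorTerm m (rep ρ x) (fun _ => z) = 0 := by
  have := h.isBigO hm hD.isOpen h0 (hD.isOriginAutomorphism_rep x)
  simp only [ContinuousLinearMap.fderiv, sub_self, zero_sub] at this
  exact this.neg_left.congr_left (fun _ => neg_neg _) |>.continuousMultilinearMap_apply_eq_zero z

/-- The bounds given by Cauchy's estimates on a bounded domain. -/
theorem exists_bound_isOriginAutomorphism (hD : IsOpen D) (hbdd : Bornology.IsBounded D)
    (h0 : (0 : Fin n → ℂ) ∈ D) (m : ℕ) :
    ∃ C : ℝ, ∀ k, IsOriginAutomorphism D k → ‖fderiv ℂ k 0‖ ≤ C ∧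
      ∀ z ∈ grid m n, ‖taylorTerm m k fun _ => z‖ ≤ C := by
  obtain ⟨M, hM⟩ := hbdd.exists_norm_le
  obtain ⟨r, hr, hrD⟩ := Metric.isOpen_iff.1 hD 0 h0
  have hM0 : 0 ≤ M := (norm_nonneg _).trans (hM 0 h0)
  have hnn : ∀ z ∈ grid m n, 0 ≤ M * (2 / r * ‖z‖) ^ m := fun z _ => by positivity
  have hsum0 := Finset.sum_nonneg hnn
  refine ⟨M / (r / 2) + ∑ z ∈ grid m n, M * (2 / r * ‖z‖) ^ m, fun k hk => ⟨?_, fun z hz => ?_⟩⟩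
  · have := norm_fderiv_le_of_forall_mem_closedBall hD hk.1.1 (z := 0) (half_pos hr)
      ((closedBall_subset_ball (half_lt_self hr)).trans hrD)
      fun y hy => hM _ (hk.1.2.1 (hrD (closedBall_subset_ball (half_lt_self hr) hy)))
    linarith
  · have h1 := norm_taylorTerm_le hr (hk.1.1.mono hrD) (fun y hy => hM _ (hk.1.2.1 (hrD hy))) m z
    have h2 := Finset.single_le_sum hnn hz
    have h3 : 0 ≤ M / (r / 2) := by positivity
    linarith

/-- The cross term is real-linear in the conjugate of `w`, so its mean over the torus is zero and it
is nonnegative at some `x`. -/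
theorem exists_gridEnergy_add_le (hρ : Continuous ρ) (hinv : InvariantsConstant ρ)
    (hμ : resonanceOrder ρ = 1) {m : ℕ} (hm : 2 ≤ m) (w : (Fin n → ℂ) [×m]→L[ℂ] (Fin n → ℂ))
    (p : (Fin n → ℂ) → Fin n → ℂ) (A B : (Fin n → ℂ) →L[ℂ] (Fin n → ℂ)) :
    ∃ x, gridEnergy m p + gridEnergy m (fun z => B (rep ρ (-x) (w fun _ => rep ρ x (A z)))) ≤
      gridEnergy m fun z => p z + B (rep ρ (-x) (w fun _ => rep ρ x (A z))) := by
  have hc : ∀ z, Continuous fun x => rep ρ (-x) (w fun _ => rep ρ x (A z)) := fun z =>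
    ((continuous_rep hρ).comp continuous_neg).clm_apply
      (w.cont.comp (continuous_pi fun _ => continuous_rep_apply hρ _))
  let T : (Fin n → ℂ) → Fin n → (Fin n → ℂ) →L[ℝ] ℝ := fun z i =>
    Complex.reCLM ∘L (((star (p z i)) • (ContinuousLinearMap.proj i ∘L B)).restrictScalars ℝ)
  have hT : ∀ z i y, T z i y = (star (p z i) * B y i).re := fun z i y => rfl
  have hcT : ∀ z i, Continuous fun x => T z i (rep ρ (-x) (w fun _ => rep ρ x (A z))) :=
    fun z i => (T z i).continuous.comp (hc z)
  have hzero : ∫ x, ∑ z ∈ grid m n, ∑ i, T z i (rep ρ (-x) (w fun _ => rep ρ x (A z)))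
      ∂torusMeasure r = 0 := by
    rw [integral_finsetSum _ fun z _ => integrable_torusMeasure
      (continuous_finsetSum _ fun i _ => hcT z i)]
    refine Finset.sum_eq_zero fun z _ => ?_
    rw [integral_finsetSum _ fun i _ => integrable_torusMeasure (hcT z i)]
    refine Finset.sum_eq_zero fun i _ => ?_
    rw [(T z i).integral_comp_comm (integrable_torusMeasure (hc z)),
      integral_rep_neg_comp_rep_eq_zero hρ hinv hμ hm, map_zero]
  obtain ⟨x, hx⟩ := exists_integral_le (μ := torusMeasure r) (integrable_torusMeasure
    (continuous_finsetSum (grid m n) fun z _ => continuous_finsetSum _ fun i _ => hcT z i))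
  rw [hzero] at hx
  refine ⟨x, ?_⟩
  rw [gridEnergy_add]
  simp only [hT] at hx
  linarith

/-- The energy argument: the Taylor terms of degree `m` define a bounded cocycle of the isotropy
group, and equivariance under the torus makes a non-zero one unbounded. -/
theorem TermsVanishBelow.taylorTerm_eq_zero {m : ℕ} (h : TermsVanishBelow D m) (hm : 2 ≤ m)
    (hρ : Continuous ρ) (hinv : InvariantsConstant ρ) (hμ : resonanceOrder ρ = 1)
    (hD : IsQuasiReinhardt ρ D) (hbdd : Bornology.IsBounded D) (h0 : (0 : Fin n → ℂ) ∈ D)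
    {k : (Fin n → ℂ) → (Fin n → ℂ)} (hk : IsOriginAutomorphism D k) (z₀ : Fin n → ℂ) :
    taylorTerm m k (fun _ => z₀) = 0 := by
  by_contra hne
  obtain ⟨C, hC⟩ := exists_bound_isOriginAutomorphism hD.isOpen hbdd h0 m
  have hC0 : 0 ≤ C := (norm_nonneg _).trans (hC k hk).1
  -- The inverse of the derivative is the derivative of the inverse automorphism, so the same Cauchy
  -- bound `C` applies to it.
  have hinvs : ∀ l, IsOriginAutomorphism D l → ∃ B : (Fin n → ℂ) →L[ℂ] (Fin n → ℂ),
      ‖B‖ ≤ C ∧ fderiv ℂ l 0 * B = 1 ∧ B * fderiv ℂ l 0 = 1 := by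
    intro l hl
    obtain ⟨g, hg, hi⟩ := hl.exists_inverse h0
    exact ⟨fderiv ℂ g 0, (hC g hg).1, hg.fderiv_mul_of_leftInvOn hl hD.isOpen h0 hi.2,
      hl.fderiv_mul_of_leftInvOn hg hD.isOpen h0 hi.1⟩
  obtain ⟨Bk, -, hABk, hBAk⟩ := hinvs k hk
  let w : (Fin n → ℂ) [×m]→L[ℂ] (Fin n → ℂ) := Bk.compContinuousMultilinearMap (taylorTerm m k)
  have hw : w (fun _ => z₀) ≠ 0 := by
    intro hw0
    have h1 : (fderiv ℂ k 0 * Bk) (taylorTerm m k fun _ => z₀) = fderiv ℂ k 0 0 := congrArg _ hw0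
    rw [hABk, map_zero] at h1
    exact hne h1
  obtain ⟨c, hc, hcle⟩ := exists_pos_le_gridEnergy w hw C
  -- The inductive step replaces `l` by k∘ρ(x)∘l, with `x` depending on `l`, and gains at least `c`.
  have hgrow : ∀ N : ℕ, ∃ l, IsOriginAutomorphism D l ∧ ∀ B : (Fin n → ℂ) →L[ℂ] (Fin n → ℂ),
      B * fderiv ℂ l 0 = 1 → N * c ≤ gridEnergy m fun z => B (taylorTerm m l fun _ => z) := by
    intro N
    induction N with
    | zero =>
      refine ⟨k, hk, fun B _ => ?_⟩
      rw [Nat.cast_zero, zero_mul]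
      exact Finset.sum_nonneg fun _ _ => Finset.sum_nonneg fun _ _ => by positivity
    | succ N ih =>
      obtain ⟨l, hl, hlN⟩ := ih
      obtain ⟨Bl, hBl, hABl, hBAl⟩ := hinvs l hl
      obtain ⟨x, hx⟩ := exists_gridEnergy_add_le hρ hinv hμ hm w
        (fun z => Bl (taylorTerm m l fun _ => z)) (fderiv ℂ l 0) Bl
      have hR := hD.isOriginAutomorphism_rep x
      have hRl := hR.comp hl
      have hdRl : fderiv ℂ (fun z => rep ρ x (l z)) 0 = rep ρ x * fderiv ℂ l 0 := by
        rw [hR.fderiv_comp hl hD.isOpen h0, ContinuousLinearMap.fderiv]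
      obtain ⟨B', hB', hAB', hBA'⟩ := hinvs _ hRl
      have hB'eq : B' = Bl * rep ρ (-x) := by
        have h1 : (Bl * rep ρ (-x)) * (rep ρ x * fderiv ℂ l 0) = 1 := by
          ext1 z
          change Bl (rep ρ (-x) (rep ρ x (fderiv ℂ l 0 z))) = z
          rw [rep_neg_apply_rep]
          exact congrArg (fun T : (Fin n → ℂ) →L[ℂ] (Fin n → ℂ) => T z) hBAl
        rw [hdRl] at hAB'
        exact (left_inv_eq_right_inv h1 hAB').symm
      -- The added term is `w` conjugated by the derivative of ρ(x)∘l. As this map is itself an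
      -- automorphism of `D`, its derivative and inverse obey the bound `C`, whatever `x` is.
      have hcx := hcle _ B' (hC _ hRl).1 hB' hAB' hBA'
      rw [hdRl, hB'eq] at hcx
      refine ⟨_, hk.comp hRl, fun B hB => ?_⟩
      have hterm : ∀ z, B (taylorTerm m (fun z => k (rep ρ x (l z))) fun _ => z) =
          Bl (taylorTerm m l fun _ => z) +
            Bl (rep ρ (-x) (w fun _ => rep ρ x (fderiv ℂ l 0 z))) := by
        intro z
        have hBeq : B = Bl * rep ρ (-x) * Bk := by
          rw [← hB'eq]
          refine left_inv_eq_right_inv hB ?_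
          rw [hk.fderiv_comp hRl hD.isOpen h0, mul_assoc, ← mul_assoc _ B', hAB', one_mul, hABk]
        rw [h.taylorTerm_comp hm hD.isOpen h0 hk hRl, h.taylorTerm_comp hm hD.isOpen h0 hR hl,
          h.taylorTerm_rep hm hD h0, add_zero, ContinuousLinearMap.fderiv, hdRl, map_add, hBeq]
        congr 1
        have h2 := congrArg (fun T : (Fin n → ℂ) →L[ℂ] (Fin n → ℂ) =>
          T (rep ρ x (taylorTerm m l fun _ => z))) hBAk
        change Bl (rep ρ (-x) (Bk (fderiv ℂ k 0 (rep ρ x (taylorTerm m l fun _ => z))))) = _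
        rw [show Bk (fderiv ℂ k 0 (rep ρ x (taylorTerm m l fun _ => z))) =
          rep ρ x (taylorTerm m l fun _ => z) from h2, rep_neg_apply_rep]
      simp only [hterm]
      have h3 := hlN Bl hBAl
      have hcx' : c ≤ gridEnergy m fun z => Bl (rep ρ (-x) (w fun _ => rep ρ x (fderiv ℂ l 0 z))) :=
        hcx
      push_cast
      linarith
  -- One factor `C` bounds the inverse derivative, the other the Taylor term on the grid; `N` is
  -- chosen so that `N * c` exceeds the resulting energy bound.
  obtain ⟨N, hN⟩ := exists_nat_gt ((∑ z ∈ grid m n, ∑ i : Fin n, (C * C) ^ 2) / c)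
  rw [div_lt_iff₀ hc] at hN
  obtain ⟨l, hl, hlN⟩ := hgrow N
  obtain ⟨Bl, hBl, -, hBAl⟩ := hinvs l hl
  refine absurd (hlN Bl hBAl) (not_le.2 (lt_of_le_of_lt ?_ hN))
  refine Finset.sum_le_sum fun z hz => Finset.sum_le_sum fun i _ => ?_
  refine pow_le_pow_left₀ (norm_nonneg _) ?_ 2
  calc ‖Bl (taylorTerm m l fun _ => z) i‖ ≤ ‖Bl (taylorTerm m l fun _ => z)‖ := norm_le_pi_norm _ i
    _ ≤ ‖Bl‖ * ‖taylorTerm m l fun _ => z‖ := Bl.le_opNorm _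
    _ ≤ C * C := mul_le_mul hBl ((hC l hl).2 z hz) (norm_nonneg _) hC0

theorem taylorTerm_eq_zero_of_isOriginAutomorphism (hρ : Continuous ρ)
    (hinv : InvariantsConstant ρ) (hμ : resonanceOrder ρ = 1) (hD : IsQuasiReinhardt ρ D)
    (hbdd : Bornology.IsBounded D) (h0 : (0 : Fin n → ℂ) ∈ D) (m : ℕ) (hm : 2 ≤ m) :
    ∀ k, IsOriginAutomorphism D k → ∀ z, taylorTerm m k (fun _ => z) = 0 := by
  induction m using Nat.strong_induction_on with
  | _ m ih =>
    have h : TermsVanishBelow D m := fun k hk j hj hjm => ih j hjm hj k hk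
    exact fun k hk => h.taylorTerm_eq_zero hm hρ hinv hμ hD hbdd h0 hk

end Isotropy

end QuasiReinhardt

theorem corollary6p3 {r n : ℕ}
    (ρ : QuasiReinhardt.Torus r →* Matrix.GeneralLinearGroup (Fin n) ℂ)
    (hρ : Continuous ρ)
    (hinv : QuasiReinhardt.InvariantsConstant ρ)
    (D : Set (Fin n → ℂ))
    (hD : QuasiReinhardt.IsQuasiReinhardt ρ D)
    (hbdd : Bornology.IsBounded D)
    (h0 : (0 : Fin n → ℂ) ∈ D)
    (hμ : QuasiReinhardt.resonanceOrder ρ = 1)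
    (f : (Fin n → ℂ) → (Fin n → ℂ))
    (hf : QuasiReinhardt.IsAutomorphism D f)
    (hf0 : f 0 = 0) :
    ∃ L : (Fin n → ℂ) →ₗ[ℂ] (Fin n → ℂ), ∀ z ∈ D, f z = L z :=
  ⟨(fderiv ℂ f 0).toLinearMap, eqOn_fderiv_of_taylorTerm_eq_zero hf.1 hD.isOpen
    hD.isConnected.isPreconnected h0 hf0 fun j hj z =>
      QuasiReinhardt.taylorTerm_eq_zero_of_isOriginAutomorphism hρ hinv hμ hD hbdd h0 j hj f
        ⟨hf, hf0⟩ z⟩
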